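/- Let $n\ge 0$, let $X_1,\dots,X_n$ be simply connected (i.e. path-connected with trivial fundamental group) CW complexes with basepoints $x_i\in X_i$, and let $\Omega X_i$ be the space of loops in $X_i$ based at $x_i$ with the compact-open topology. For a space $A$ let $CA=(A\times[0,1])/(A\times\{1\})$ be its cone with the quotient topology, containing $A$ as $A\times\{0\}$. Let $K$ be an abstract simplicial complex with vertex set $\{1,\dots,n\}$, that is, a family of subsets of $\{1,\dots,n\}$ which is closed under passing to subsets and contains $\varnothing$ and every $\{i\}$, $1\le i\le n$. Then the polyhedral product $$Z_K(\underline{C\Omega X},\underline{\Omega X})=\bigcup_{\sigma\in K}\ \prod_{i=1}^n Y_i^\sigma\ \subseteq\ \prod_{i=1}^n C\Omega X_i,\qquad Y_i^\sigma=\begin{cases}C\Omega X_i,& i\in\sigma,\\ \Omega X_i,& i\notin\sigma,\end{cases}$$ with the subspace topology, is simply connected. -/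

import Mathlib

universe u

/-- An abstract simplicial complex on the index set `{1, …, n}` (modelled by `Fin n`): a family of
subsets that contains the empty set and is closed under passing to subsets. A one-element set is
not required to be a simplex. -/
structure SimplicialComplexOn (n : ℕ) where
  faces : Set (Finset (Fin n))
  empty_mem : ∅ ∈ faces
  down_closed : ∀ ⦃σ τ : Finset (Fin n)⦄, σ ∈ faces → τ ⊆ σ → τ ∈ faces

/-- The relation on `A × [0,1]` that collapses `A × {1}` to a point. -/
def coneSetoid (A : Type u) : Setoid (A × unitInterval) where
  r p q := p = q ∨ (p.2 = 1 ∧ q.2 = 1)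
  iseqv :=
    { refl := fun _ => Or.inl rfl
      symm := by
        rintro p q (h | ⟨h₁, h₂⟩)
        · exact Or.inl h.symm
        · exact Or.inr ⟨h₂, h₁⟩
      trans := by
        rintro p q r (rfl | ⟨h₁, h₂⟩) (rfl | ⟨h₃, h₄⟩)
        · exact Or.inl rfl
        · exact Or.inr ⟨h₃, h₄⟩
        · exact Or.inr ⟨h₁, h₂⟩
        · exact Or.inr ⟨h₁, h₄⟩ }

/-- The cone `CA = (A × [0,1]) / (A × {1})` on a (nonempty) space `A`. -/
def TopCone (A : Type u) : Type u := Quotient (coneSetoid A)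

namespace TopCone

/-- The cone carries the quotient topology of `A × [0,1]`. -/
instance instTopologicalSpace (A : Type u) [TopologicalSpace A] : TopologicalSpace (TopCone A) :=
  inferInstanceAs (TopologicalSpace (Quotient (coneSetoid A)))

/-- The class in the cone of the pair `(a, t)`. -/
def mk {A : Type u} (a : A) (t : unitInterval) : TopCone A := Quotient.mk (coneSetoid A) (a, t)

/-- The copy `A × {0}` of `A` inside the cone `CA`. -/
def base (A : Type u) : Set (TopCone A) := Set.range fun a : A => mk a 0

end TopCone

/-- The product `D(σ) = Y₁ × ⋯ × Yₙ ⊆ X₁ × ⋯ × Xₙ` with `Yᵢ = Xᵢ` if `i ∈ σ` and `Yᵢ = Aᵢ` if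
`i ∉ σ`. -/
def polyhedralBlock {n : ℕ} {X : Fin n → Type u} (A : ∀ i, Set (X i)) (σ : Finset (Fin n)) :
    Set (∀ i, X i) :=
  Set.univ.pi fun i => if i ∈ σ then Set.univ else A i

/-- The polyhedral product `Z_K(X, A) = ⋃_{σ ∈ K} D(σ) ⊆ X₁ × ⋯ × Xₙ`; as a space it carries the
subspace topology of the product. -/
def polyhedralProduct {n : ℕ} (K : SimplicialComplexOn n) {X : Fin n → Type u}
    (A : ∀ i, Set (X i)) : Set (∀ i, X i) :=
  ⋃ σ ∈ K.faces, polyhedralBlock A σ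

/-! Only path-connectedness of the `Ω Xᵢ` matters, and it follows from simple connectedness of `Xᵢ`.
Cover `Z_K` by the open sets `U_σ`, `σ ∈ K`, where coordinates outside `σ` avoid the apex. In place
of van Kampen, one fixes paths from a base point to every `z` that stay in each `U_σ` containing
`z`; subdividing then reduces everything to loops in a single `U_σ`
(`simplyConnectedSpace_of_openCover`). Such a loop slides down the cone lines into `D(σ)`, where its
cone coordinates contract, leaving a loop in `∏ Aᵢ` (`homotopic_refl_of_height_ne_one`). That loop
is a product of loops moving one coordinate each, and the `i`-th dies in the cone `CAᵢ`, available
because `{i} ∈ K` (`map_baseMap_homotopic_refl`). -/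

/-! ### A criterion for simple connectedness -/

section OpenCover

variable {Z ι : Type*} [TopologicalSpace Z] {U : ι → Set Z} {z₀ : Z}

/-- If all loops at `z₀` inside each member of an open cover are null-homotopic, and every point
`z` is joined to `z₀` by a path `c z` that stays in each member of the cover containing `z`, then
every path `γ` from `a` to `b` satisfies `[c a] * [γ] = [c b]`. -/
theorem Path.Homotopic.mk_trans_mk_eq_of_openCover (hU : ∀ i, IsOpen (U i))
    (hcover : ∀ z, ∃ i, z ∈ U i) (c : ∀ z, Path z₀ z)
    (hc : ∀ z i, z ∈ U i → ∀ t, c z t ∈ U i)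
    (hloop : ∀ i (γ : Path z₀ z₀), (∀ t, γ t ∈ U i) → γ.Homotopic (Path.refl z₀))
    {a b : Z} (γ : Path a b) :
    (Quotient.mk (c a)).trans (Quotient.mk γ) = Quotient.mk (c b) := by
  have small : ∀ i {a b : Z} (p : Path a b), (∀ t, p t ∈ U i) →
      (Quotient.mk (c a)).trans (Quotient.mk p) = Quotient.mk (c b) := by
    intro i a b p hp
    have ha : a ∈ U i := by simpa using hp 0
    have hb : b ∈ U i := by simpa using hp 1
    have h : (((c a).trans p).trans (c b).symm).Homotopic (Path.refl z₀) := by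
      refine hloop i _ fun t => ?_
      have ht := Set.mem_range_self (f := ((c a).trans p).trans (c b).symm) t
      rw [Path.trans_range, Path.trans_range, Path.symm_range] at ht
      rcases ht with (⟨s, hs⟩ | ⟨s, hs⟩) | ⟨s, hs⟩
      · exact hs ▸ hc a i ha s
      · exact hs ▸ hp s
      · exact hs ▸ hc b i hb s
    rw [← Quotient.eq, Quotient.mk_trans, Quotient.mk_trans, Quotient.mk_symm,
      Quotient.mk_refl] at h
    calc (Quotient.mk (c a)).trans (Quotient.mk p)
        = (((Quotient.mk (c a)).trans (Quotient.mk p)).trans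
            (Quotient.mk (c b)).symm).trans (Quotient.mk (c b)) := by simp
      _ = Quotient.mk (c b) := by rw [h, Quotient.refl_trans]
  obtain ⟨t, ht0, hmono, ⟨N, hN⟩, hsub⟩ :=
    exists_monotone_Icc_subset_open_cover_unitInterval (c := fun i => γ ⁻¹' U i)
      (fun i => (hU i).preimage γ.continuous)
      (fun s _ => Set.mem_iUnion.2 (hcover (γ s)))
  -- Telescoping over a Lebesgue subdivision: each piece of `γ` lies in one member of the cover, so
  -- `small` applies to it.
  have steps : ∀ m, (Quotient.mk (c (γ 0))).trans (Quotient.mk (γ.subpath 0 (t m)))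
      = Quotient.mk (c (γ (t m))) := by
    intro m
    induction m with
    | zero => rw [ht0, Path.subpath_self, Quotient.mk_refl, Quotient.trans_refl]
    | succ m ih =>
      obtain ⟨i, hi⟩ := hsub m
      have hlast := small i (γ.subpath (t m) (t (m + 1))) fun s => by
        have hs := Set.mem_range_self (f := γ.subpath (t m) (t (m + 1))) s
        rw [Path.range_subpath_of_le _ _ _ (hmono m.le_succ)] at hs
        obtain ⟨r, hr, hrs⟩ := hs
        exact hrs ▸ hi hr
      have hcomp : (Quotient.mk (γ.subpath 0 (t m))).trans
          (Quotient.mk (γ.subpath (t m) (t (m + 1)))) = Quotient.mk (γ.subpath 0 (t (m + 1))) := by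
        rw [← Quotient.mk_trans, Quotient.eq]
        exact ⟨Path.Homotopy.subpathTransSubpath γ _ _ _⟩
      rw [← hcomp, ← Quotient.trans_assoc, ih, hlast]
  have hend := steps N
  rw [hN N le_rfl, Path.subpath_zero_one] at hend
  -- `γ 0 = a` and `γ 1 = b` are not definitional; freeing the endpoints lets `rfl` remove the cast.
  have uncast : ∀ {a' b' : Z} (ha : a' = a) (hb : b' = b),
      (Quotient.mk (c a')).trans (Quotient.mk (γ.cast ha hb)) = Quotient.mk (c b') →
      (Quotient.mk (c a)).trans (Quotient.mk γ) = Quotient.mk (c b) := by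
    rintro _ _ rfl rfl h
    exact h
  exact uncast γ.source γ.target hend

/-- A space is simply connected if it has an open cover such that every point `z` can be joined to
`z₀` by a path that stays in each member of the cover containing `z`, and all loops at `z₀` inside
a single member of the cover are null-homotopic in the whole space. -/
theorem simplyConnectedSpace_of_openCover (hU : ∀ i, IsOpen (U i))
    (hcover : ∀ z, ∃ i, z ∈ U i) (c : ∀ z, Path z₀ z)
    (hc : ∀ z i, z ∈ U i → ∀ t, c z t ∈ U i)
    (hloop : ∀ i (γ : Path z₀ z₀), (∀ t, γ t ∈ U i) → γ.Homotopic (Path.refl z₀)) :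
    SimplyConnectedSpace Z := by
  rw [simply_connected_iff_paths_homotopic']
  refine ⟨⟨⟨z₀⟩, fun x y => ⟨(c x).symm.trans (c y)⟩⟩, fun {x y} p q => ?_⟩
  have key := fun γ : Path x y =>
    Path.Homotopic.mk_trans_mk_eq_of_openCover hU hcover c hc hloop γ
  have cancel : ∀ γ : Path x y, Path.Homotopic.Quotient.mk γ =
      (Path.Homotopic.Quotient.mk (c x)).symm.trans (Path.Homotopic.Quotient.mk (c y)) :=
    fun γ => by
      rw [← key γ, ← Path.Homotopic.Quotient.trans_assoc, Path.Homotopic.Quotient.symm_trans,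
        Path.Homotopic.Quotient.refl_trans]
  rw [← Path.Homotopic.Quotient.eq, cancel p, cancel q]

end OpenCover

/-! ### Loops in products -/

/-- A map out of a finite product kills all loops at `a` as soon as it kills those loops in which
only one coordinate moves. -/
theorem Path.Homotopic.map_refl_of_forall_update {ι Z : Type*} [Fintype ι] [DecidableEq ι]
    {A : ι → Type*} [∀ i, TopologicalSpace (A i)] [TopologicalSpace Z] (f : C(∀ i, A i, Z))
    {a : ∀ i, A i}
    (hf : ∀ i (p : Path (a i) (a i)),
      ((Path.pi (Function.update (fun j => Path.refl (a j)) i p)).map f.continuous).Homotopic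
        (Path.refl (f a)))
    (q : Path a a) : (q.map f.continuous).Homotopic (Path.refl (f a)) := by
  -- `P S` follows `q` in the coordinates in `S` and rests in the others.
  let P : Finset ι → Path a a := fun S =>
    Path.pi (S.piecewise (fun j => q.map (continuous_apply j)) fun j => Path.refl (a j))
  have hP : ∀ S, ((P S).map f.continuous).Homotopic (Path.refl (f a)) := by
    intro S
    induction S using Finset.induction_on with
    | empty =>
      have : (P ∅).map f.continuous = Path.refl (f a) := by
        ext t; simp only [P, Finset.piecewise_empty]; rfl
      rw [this]
    | insert i S hi ih =>
      let p : Path (a i) (a i) := q.map (continuous_apply i)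
      have hsplit : (P (insert i S)).Homotopic
          ((P S).trans (Path.pi (Function.update (fun j => Path.refl (a j)) i p))) := by
        rw [Path.trans_pi_eq_pi_trans]
        have hcoord : ∀ j, Path.Homotopic
            ((insert i S).piecewise (fun j => q.map (continuous_apply j))
              (fun j => Path.refl (a j)) j)
            ((S.piecewise (fun j => q.map (continuous_apply j)) (fun j => Path.refl (a j)) j).trans
              (Function.update (fun j => Path.refl (a j)) i p j)) := by
          intro j
          by_cases hj : j = i
          · subst hj
            rw [Finset.piecewise_insert_self, Finset.piecewise_eq_of_notMem _ _ _ hi,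
              Function.update_self]
            exact (Path.Homotopic.refl_trans _).symm
          · rw [Finset.piecewise_insert_of_ne (h := hj), Function.update_of_ne hj]
            exact (Path.Homotopic.trans_refl _).symm
        exact ⟨Path.Homotopic.piHomotopy _ _ fun j => (hcoord j).some⟩
      refine (hsplit.map f).trans ?_
      rw [Path.map_trans]
      exact (ih.hcomp (hf i p)).trans (Path.Homotopic.refl_trans _)
  have huniv : P Finset.univ = q := by
    ext t; simp only [P, Finset.piecewise_univ]; rfl
  simpa only [huniv] using hP Finset.univ

/-! ### Loop spaces -/

/-- The space of paths between two points of a simply connected space is path-connected. -/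
theorem Path.pathConnectedSpace {X : Type*} [TopologicalSpace X] [SimplyConnectedSpace X]
    (x y : X) : PathConnectedSpace (Path x y) where
  nonempty := PathConnectedSpace.joined x y
  joined p q := by
    obtain ⟨F⟩ := SimplyConnectedSpace.paths_homotopic p q
    -- A homotopy rel endpoints, curried, is a path in the path space.
    exact ⟨{  toFun := F.eval
              continuous_toFun := Path.continuous_uncurry_iff.1 F.continuous
              source' := F.eval_zero
              target' := F.eval_one }⟩

/-! ### Cones -/

namespace TopCone

variable {A : Type u}

/-- The height function `[a, t] ↦ t` on the cone. -/
def height : TopCone A → unitInterval :=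
  Quotient.lift Prod.snd (by rintro p q (rfl | ⟨h₁, h₂⟩); exacts [rfl, h₁.trans h₂.symm])

/-- A choice of a point `a` with `z = [a, t]`; it is unique away from the apex. -/
noncomputable def foot (z : TopCone A) : A := (Quotient.out z).1

@[simp]
theorem height_mk (a : A) (t : unitInterval) : height (mk a t) = t := rfl

theorem mk_foot_height (z : TopCone A) : mk (foot z) (height z) = z := by
  have h : height z = (Quotient.out z).2 := (congrArg height (Quotient.out_eq z)).symm
  rw [h]
  exact Quotient.out_eq z

theorem mk_one (a b : A) : mk a 1 = mk b 1 := Quotient.sound (Or.inr ⟨rfl, rfl⟩)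

theorem foot_mk (a : A) {t : unitInterval} (ht : t ≠ 1) : foot (mk a t) = a := by
  rcases Quotient.exact (Quotient.out_eq (mk a t)) with h | h
  · exact congrArg Prod.fst h
  · exact absurd h.2 ht

theorem mem_base_iff {z : TopCone A} : z ∈ base A ↔ height z = 0 := by
  constructor
  · rintro ⟨a, rfl⟩; rfl
  · intro h; exact ⟨foot z, by rw [← h]; exact mk_foot_height z⟩

variable [TopologicalSpace A]

theorem isQuotientMap_mk : Topology.IsQuotientMap fun p : A × unitInterval => mk p.1 p.2 :=
  isQuotientMap_quot_mk

@[fun_prop]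
theorem continuous_height : Continuous (height : TopCone A → unitInterval) :=
  isQuotientMap_mk.continuous_iff.2 continuous_snd

/-- A quotient map remains one over an open set, and away from the apex `foot` lifts to the first
projection. -/
theorem continuousOn_foot : ContinuousOn (foot : TopCone A → A) {z | height z ≠ 1} := by
  rw [isQuotientMap_mk.continuousOn_isOpen_iff (isOpen_ne_fun continuous_height continuous_const)]
  exact continuous_fst.continuousOn.congr fun p hp => foot_mk p.1 hp

@[fun_prop]
theorem continuous_mk {T : Type*} [TopologicalSpace T] {f : T → A} {g : T → unitInterval}
    (hf : Continuous f) (hg : Continuous g) : Continuous fun t => mk (f t) (g t) :=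
  isQuotientMap_mk.continuous.comp (hf.prodMk hg)

instance contractibleSpace [Nonempty A] : ContractibleSpace (TopCone A) := by
  obtain ⟨a₀⟩ := ‹Nonempty A›
  -- Currying reduces continuity to the quotient map itself, so its product with the interval need
  -- not be known to be a quotient map.
  let push : TopCone A → C(unitInterval, TopCone A) := fun z =>
    ⟨fun s => mk (foot z) (height z ⊔ s), by fun_prop⟩
  have hpush : Continuous push := by
    rw [isQuotientMap_mk.continuous_iff]
    refine ContinuousMap.continuous_of_continuous_uncurry _ ?_
    have h : Continuous fun p : (A × unitInterval) × unitInterval => mk p.1.1 (p.1.2 ⊔ p.2) := by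
      fun_prop
    refine h.congr ?_
    rintro ⟨⟨a, t⟩, s⟩
    change mk a (t ⊔ s) = mk (foot (mk a t)) (t ⊔ s)
    -- At the apex `foot` is an arbitrary choice, but the height stays `1`, where all feet agree.
    by_cases ht : t = 1
    · subst ht
      rw [sup_eq_left.2 unitInterval.le_one']
      exact mk_one _ _
    · rw [foot_mk a ht]
  rw [contractible_iff_id_nullhomotopic]
  refine ⟨mk a₀ 1, ⟨{
    toFun := fun p => push p.2 p.1
    continuous_toFun :=
      (ContinuousMap.continuous_uncurry_of_continuous ⟨push, hpush⟩).comp continuous_swap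
    map_zero_left := fun z => ?_
    map_one_left := fun z => ?_ }⟩⟩
  · change mk (foot z) (height z ⊔ 0) = z
    rw [sup_eq_left.2 unitInterval.nonneg', mk_foot_height]
  · change mk (foot z) (height z ⊔ 1) = mk a₀ 1
    rw [sup_eq_right.2 unitInterval.le_one']
    exact mk_one _ _

end TopCone

/-! ### Polyhedral products of cones -/

section PolyhedralProduct

open TopCone

variable {n : ℕ} {K : SimplicialComplexOn n} {A : Fin n → Type u}

theorem mem_polyhedralProduct_base_iff {z : ∀ i, TopCone (A i)} :
    z ∈ polyhedralProduct K (fun i => base (A i)) ↔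
      ∃ σ ∈ K.faces, ∀ i ∉ σ, height (z i) = 0 := by
  simp only [polyhedralProduct, Set.mem_iUnion, exists_prop, polyhedralBlock, Set.mem_univ_pi]
  refine exists_congr fun σ => and_congr_right fun _ => forall_congr' fun i => ?_
  by_cases hi : i ∈ σ <;> simp [hi, mem_base_iff]

variable [∀ i, TopologicalSpace (A i)]

/-- The map `∏ CAᵢ × ∏ Aᵢ → Z_K(CA, A)` that takes the coordinates in the simplex `σ` from the
first factor and the other coordinates from the second one. -/
def blockMap {σ : Finset (Fin n)} (hσ : σ ∈ K.faces) :
    C((∀ i, TopCone (A i)) × (∀ i, A i), polyhedralProduct K fun i => base (A i)) where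
  toFun p := ⟨fun i => if i ∈ σ then p.1 i else mk (p.2 i) 0,
    mem_polyhedralProduct_base_iff.2 ⟨σ, hσ, fun i hi => by simp [hi]⟩⟩
  continuous_toFun := by
    refine Continuous.subtype_mk (continuous_pi fun i => ?_) _
    by_cases hi : i ∈ σ
    · simp only [hi, if_true]; fun_prop
    · simp only [hi, if_false]; fun_prop

variable (K) in
/-- The inclusion `∏ Aᵢ → Z_K(CA, A)`. -/
def baseMap : C(∀ i, A i, polyhedralProduct K fun i => base (A i)) where
  toFun a := ⟨fun i => mk (a i) 0,
    mem_polyhedralProduct_base_iff.2 ⟨∅, K.empty_mem, fun _ _ => rfl⟩⟩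
  continuous_toFun := by fun_prop

theorem blockMap_base {σ : Finset (Fin n)} (hσ : σ ∈ K.faces) (a : ∀ i, A i) :
    blockMap hσ (fun i => mk (a i) 0, a) = baseMap K a :=
  Subtype.ext <| funext fun _ => ite_self _

theorem continuous_coord (i : Fin n) :
    Continuous fun z : polyhedralProduct K fun i => base (A i) => z.1 i :=
  (continuous_apply i).comp continuous_subtype_val

/-- If all vertices are simplices, every loop in `∏ Aᵢ` is null-homotopic in `Z_K(CA, A)`. -/
theorem map_baseMap_homotopic_refl (hK : ∀ i : Fin n, {i} ∈ K.faces) {a : ∀ i, A i}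
    (q : Path a a) : (q.map (baseMap K).continuous).Homotopic (Path.refl (baseMap K a)) := by
  refine Path.Homotopic.map_refl_of_forall_update (baseMap K) (fun i p => ?_) q
  have : Nonempty (A i) := ⟨a i⟩
  let f : C(TopCone (A i), polyhedralProduct K fun i => base (A i)) :=
    ⟨fun z => blockMap (hK i) (Function.update (fun j => mk (a j) 0) i z, a), by fun_prop⟩
  have hfa : baseMap K a = f (mk (a i) 0) := by
    rw [← blockMap_base (hK i)]
    simp [f]
  have hnull := SimplyConnectedSpace.paths_homotopic
    (p.map (f := fun b : A i => mk b 0) (by fun_prop)) (Path.refl _)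
  convert (hnull.map f).pathCast hfa hfa using 1
  · refine Path.ext (funext fun t => Subtype.ext (funext fun j => ?_))
    change mk (Function.update (fun j => Path.refl (a j)) i p j t) 0 =
      if j ∈ ({i} : Finset (Fin n)) then
        Function.update (fun j => mk (a j) 0) i (mk (p t) 0) j else mk (a j) 0
    by_cases hj : j = i
    · subst hj
      simp
    · simp [hj]
  · exact Path.ext (funext fun t => hfa)

/-- A loop in `Z_K(CA, A)` whose coordinates outside the simplex `σ` avoid the apex can be pushed
into `D(σ)`, and hence is null-homotopic. -/
theorem homotopic_refl_of_height_ne_one (hK : ∀ i : Fin n, {i} ∈ K.faces) {a : ∀ i, A i}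
    {σ : Finset (Fin n)} (hσ : σ ∈ K.faces) (γ : Path (baseMap K a) (baseMap K a))
    (hγ : ∀ t, ∀ i ∉ σ, height ((γ t).1 i) ≠ 1) :
    γ.Homotopic (Path.refl (baseMap K a)) := by
  have : ∀ i, Nonempty (A i) := fun i => ⟨a i⟩
  have hfoot : ∀ i ∉ σ, Continuous fun t => foot ((γ t).1 i) := fun i hi =>
    continuousOn_foot.comp_continuous ((continuous_coord i).comp γ.continuous) fun t => hγ t i hi
  let p : Path (fun i => mk (a i) 0) (fun i => mk (a i) 0) := γ.map continuous_subtype_val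
  -- Coordinates in `σ` may cross the apex, where `foot` can jump, so they are frozen at `a i`.
  let q : Path a a :=
    { toFun := fun t i => if i ∈ σ then a i else foot ((γ t).1 i)
      continuous_toFun := by
        refine continuous_pi fun i => ?_
        by_cases hi : i ∈ σ
        · simp only [hi, if_true]; fun_prop
        · simp only [hi, if_false]; exact hfoot i hi
      source' := by
        ext i; rw [γ.source]; simp [baseMap, foot_mk]
      target' := by
        ext i; rw [γ.target]; simp [baseMap, foot_mk] }
  have hb := (blockMap_base hσ a).symm
  have hcoord : ∀ i, Continuous fun x : unitInterval × unitInterval => (γ x.2).1 i := fun i =>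
    (continuous_coord i).comp (γ.continuous.comp continuous_snd)
  have hsquash : γ.Homotopic (((p.prod q).map (blockMap hσ).continuous).cast hb hb) := by
    refine ⟨{
      toFun := fun x => ⟨fun i => if i ∈ σ then (γ x.2).1 i else
          mk (foot ((γ x.2).1 i)) (unitInterval.symm x.1 * height ((γ x.2).1 i)), ?_⟩
      continuous_toFun := ?_
      map_zero_left := fun t => ?_
      map_one_left := fun t => ?_
      prop' := ?_ }⟩
    -- Scaling preserves height `0`, so the simplex `τ` that places `γ x.2` in `Z_K` still works.
    · obtain ⟨τ, hτ, h⟩ := mem_polyhedralProduct_base_iff.1 (γ x.2).2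
      refine mem_polyhedralProduct_base_iff.2 ⟨τ, hτ, fun i hi => ?_⟩
      by_cases hiσ : i ∈ σ <;> simp [hiσ, h i hi]
    · refine Continuous.subtype_mk (continuous_pi fun i => ?_) _
      by_cases hi : i ∈ σ
      · simp only [hi, if_true]
        exact hcoord i
      · simp only [hi, if_false]
        exact continuous_mk ((hfoot i hi).comp continuous_snd)
          ((unitInterval.continuous_symm.comp continuous_fst).mul
            (continuous_height.comp (hcoord i)))
    · refine Subtype.ext (funext fun i => ?_)
      simp [mk_foot_height]
    · refine Subtype.ext (funext fun i => ?_)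
      change _ = if i ∈ σ then (γ t).1 i else mk (if i ∈ σ then a i else foot ((γ t).1 i)) 0
      by_cases hi : i ∈ σ <;> simp [hi]
    · have hfix : ∀ s t, γ t = baseMap K a → ∀ i, (if i ∈ σ then (γ t).1 i else
          mk (foot ((γ t).1 i)) (unitInterval.symm s * height ((γ t).1 i))) = (γ t).1 i := by
        intro s t ht i
        rw [ht]
        simp [baseMap, foot_mk]
      rintro s t (rfl | rfl)
      · exact Subtype.ext (funext (hfix s 0 γ.source))
      · exact Subtype.ext (funext (hfix s 1 γ.target))
  have hcontract : (p.prod q).Homotopic ((Path.refl _).prod q) :=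
    ⟨Path.Homotopic.prodHomotopy
      (Path.Homotopic.piHomotopy (fun i => p.map (continuous_apply i)) (fun i => Path.refl _)
        fun _ => (SimplyConnectedSpace.paths_homotopic _ _).some)
      (Path.Homotopy.refl q)⟩
  have hbase : (((Path.refl _).prod q).map (blockMap hσ).continuous).cast hb hb =
      q.map (baseMap K).continuous := by
    refine Path.ext (funext fun t => Subtype.ext (funext fun i => ?_))
    change (if i ∈ σ then mk (a i) 0 else mk (if i ∈ σ then a i else foot ((γ t).1 i)) 0) =
      mk (if i ∈ σ then a i else foot ((γ t).1 i)) 0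
    by_cases hi : i ∈ σ <;> simp [hi]
  exact (hsquash.trans ((hcontract.map (blockMap hσ)).pathCast hb hb)).trans
    (hbase ▸ map_baseMap_homotopic_refl hK q)

/-- Every point `z` of `Z_K(CA, A)` can be joined to a given point of `∏ Aᵢ` by a path along which
those coordinates that differ from the apex at `z` never meet the apex. -/
theorem exists_path_height_ne_one [∀ i, PathConnectedSpace (A i)] (a : ∀ i, A i)
    (z : polyhedralProduct K fun i => base (A i)) :
    ∃ c : Path (baseMap K a) z, ∀ i, height (z.1 i) ≠ 1 → ∀ t, height ((c t).1 i) ≠ 1 := by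
  let q : Path a fun i => foot (z.1 i) := Path.pi fun i => PathConnectedSpace.somePath _ _
  -- Climbs the cone lines through `z`: heights `s * height` never exceed those of `z`.
  let r : Path (baseMap K fun i => foot (z.1 i)) z :=
    { toFun := fun s => ⟨fun i => mk (foot (z.1 i)) (s * height (z.1 i)), by
        obtain ⟨τ, hτ, h⟩ := mem_polyhedralProduct_base_iff.1 z.2
        exact mem_polyhedralProduct_base_iff.2 ⟨τ, hτ, fun i hi => by simp [h i hi]⟩⟩
      continuous_toFun := by fun_prop
      source' := Subtype.ext (funext fun i => by simp [baseMap])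
      target' := Subtype.ext (funext fun i => by simp [mk_foot_height]) }
  refine ⟨(q.map (baseMap K).continuous).trans r, fun i hi t => ?_⟩
  have ht := Set.mem_range_self (f := (q.map (baseMap K).continuous).trans r) t
  rw [Path.trans_range] at ht
  rcases ht with ⟨s, hs⟩ | ⟨s, hs⟩ <;> rw [← hs]
  · exact zero_ne_one
  · exact ((unitInterval.mul_le_right (x := s)).trans_lt
      (lt_of_le_of_ne unitInterval.le_one' hi)).ne

/-- The polyhedral product `Z_K(CA, A)` of path-connected spaces is simply connected if all
vertices are simplices of `K`. -/
theorem simplyConnectedSpace_polyhedralProduct_cone [∀ i, PathConnectedSpace (A i)]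
    (hK : ∀ i : Fin n, {i} ∈ K.faces) :
    SimplyConnectedSpace (polyhedralProduct K fun i => base (A i)) := by
  let a : ∀ i, A i := fun i => Classical.arbitrary (A i)
  choose c hc using exists_path_height_ne_one (K := K) a
  refine simplyConnectedSpace_of_openCover
    (U := fun σ : K.faces => {z : polyhedralProduct K fun i => base (A i) |
      ∀ i ∉ σ.1, height (z.1 i) ≠ 1})
    (fun σ => ?_) (fun z => ?_) c (fun z σ hz t i hi => hc z i (hz i hi) t)
    (fun σ γ hγ => homotopic_refl_of_height_ne_one hK σ.2 γ hγ)
  · simp only [Set.ofPred_forall]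
    exact isOpen_iInter_of_finite fun i => isOpen_iInter_of_finite fun _ =>
      isOpen_ne_fun (continuous_height.comp (continuous_coord i)) continuous_const
  · obtain ⟨σ, hσ, h⟩ := mem_polyhedralProduct_base_iff.1 z.2
    exact ⟨⟨σ, hσ⟩, fun i hi => by simp [h i hi]⟩

end PolyhedralProduct

theorem theorem1p3 {n : ℕ} (K : SimplicialComplexOn n) (hK : ∀ i : Fin n, {i} ∈ K.faces)
    (X : Fin n → Type u) [∀ i, TopologicalSpace (X i)] [∀ i, T2Space (X i)]
    [∀ i, Topology.CWComplex (Set.univ : Set (X i))] [∀ i, SimplyConnectedSpace (X i)]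
    (x : ∀ i, X i) :
    SimplyConnectedSpace
      (polyhedralProduct K fun i => TopCone.base (LoopSpace (X i) (x i))) := by
  have : ∀ i, PathConnectedSpace (LoopSpace (X i) (x i)) := fun i =>
    Path.pathConnectedSpace (x i) (x i)
  exact simplyConnectedSpace_polyhedralProduct_cone hK
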